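/- **Setting.** Let $\mathcal D\subseteq\mathbb R^n$ be open and connected with $0\in\mathcal D$, let $t_0\in\mathbb R$, $\Omega=\mathcal D\times[t_0,\infty)$, and let $F:\mathbb R^n\times[t_0,\infty)\rightrightarrows\mathbb R^n$ be a set-valued map with compact values. For $0<\delta<\Delta$ put $\mathrm D(\delta,\Delta)=\{x\in\mathbb R^n:\delta\le\|x\|\le\Delta\}$ and let $\overline{\mathrm B}(0,r)$ denote a closed Euclidean ball. **Solutions and stability.** A solution of $\dot x\in F(x,t)$ starting at time $s\ge t_0$ is a locally absolutely continuous function $x$ on an interval $[s,b)$, $s<b\le\infty$, with $\dot x(t)\in F(x(t),t)$ for almost every $t$; it is maximal if no proper right extension is a solution, and complete if $b=\infty$. Below, "solution" means a maximal solution with an arbitrary initial time $s\ge t_0$. The inclusion is * *uniformly stable* at $0$ if for every $\epsilon>0$ there is $\delta>0$ such that every solution with $\|x(s)\|\le\delta$ is complete and satisfies $\|x(t)\|\le\epsilon$ for all $t\ge s$; * *uniformly globally stable* at $0$ if it is uniformly stable at $0$ and for every $\epsilon>0$ there is $\Delta>0$ such that every solution with $\|x(s)\|\le\epsilon$ is complete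 and satisfies $\|x(t)\|\le\Delta$ for all $t\ge s$; * *uniformly asymptotically stable* at $0$ if it is uniformly stable at $0$ and there is $c>0$ such that for every $\epsilon>0$ there is $T\ge0$ such that every solution with $\|x(s)\|\le c$ is complete and satisfies $\|x(t)\|\le\epsilon$ for all $t\ge s+T$; * *uniformly globally asymptotically stable* at $0$ if it is uniformly stable at $0$ and for all $c,\epsilon>0$ there is $T\ge0$ such that every solution with $\|x(s)\|\le c$ is complete and satisfies $\|x(t)\|\le\epsilon$ for all $t\ge s+T$. **Generalized derivatives.** For a locally Lipschitz real function $V$ with domain $S\subseteq\mathbb R^n\times\mathbb R$, the Clarke gradient $\partial V(z)$ is the closed convex hull of all limits $\lim\nabla V(z_i)$ with $z_i\to z$, where the $z_i$ are interior points of $S$ at which $V$ is differentiable. $V$ is *regular* if at each interior point $z$ of $S$ and for each direction $v$ the one-sided directional derivative $\lim_{h\downarrow0}(V(z+hv)-V(z))/h$ exists and equals $\limsup_{y\to z,\,h\downarrow0}(V(y+hv)-V(y))/h$. For a countable collection $\mathcal U=\{U_i\}_{i\ge 1}$ of regular locally Lipschitz functions put $$\tilde F_{\mathcal U}(x,t)=\bigcap_i\{q\in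 F(x,t): p^T[q;1]\text{ is the same number for all }p\in\partial U_i(x,t)\}.$$ The $\mathcal U$-generalized derivative of a locally Lipschitz $V:\Omega\to\mathbb R$ is $$\dot{\overline V}_{\mathcal U}(x,t)=\min_{p\in\partial V(x,t)}\ \max_{q\in\tilde F_{\mathcal U}(x,t)}p^T[q;1]\quad\text{if }V\text{ is regular},\qquad \dot{\overline V}_{\mathcal U}(x,t)=\max_{p\in\partial V(x,t)}\ \max_{q\in\tilde F_{\mathcal U}(x,t)}p^T[q;1]\quad\text{otherwise},$$ and $-\infty$ when $\tilde F_{\mathcal U}(x,t)=\emptyset$. **Matrosov functions.** Let $\mathrm D(\delta,\Delta)\subset\mathcal D$. Locally Lipschitz functions $W_1,\dots,W_M:\Omega\to\mathbb R$ are *Matrosov functions* for $(F,\delta,\Delta)$ if there exist $m$, $\phi:\Omega\to\mathbb R^m$, $\gamma>0$ and continuous $Y_1,\dots,Y_M:\overline{\mathrm B}(0_m,\gamma)\times\mathrm D(\delta,\Delta)\to\mathbb R$ such that 1. (nested Matrosov property) with $Y_0\equiv0$ and $Y_{M+1}\equiv1$, for every $j\in\{0,\dots,M\}$ and every $(z,x)\in\overline{\mathrm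 B}(0_m,\gamma)\times\mathrm D(\delta,\Delta)$: if $Y_i(z,x)=0$ for all $i\in\{0,\dots,j\}$, then $Y_{j+1}(z,x)\le0$; 2. $\max\{|W_j(x,t)|,\|\phi(x,t)\|\}\le\gamma$ for all $j\in\{1,\dots,M\}$ and $(x,t)\in\mathrm D(\delta,\Delta)\times[t_0,\infty)$; 3. for every $j\in\{1,\dots,M\}$ there is a countable collection $\mathcal U_j$ of regular locally Lipschitz functions defined on a set containing $\mathrm D(\delta,\Delta)\times[t_0,\infty)$ such that $\dot{\overline{W_j}}_{\mathcal U_j}(x,t)\le Y_j(\phi(x,t),x)$ for all $(x,t)\in\mathrm D(\delta,\Delta)\times[t_0,\infty)$. **Theorem.** Suppose that $\dot x\in F(x,t)$ is uniformly stable at $0$ and that for all $0<\delta<\Delta$ with $\mathrm D(\delta,\Delta)\subset\mathcal D$ there exist Matrosov functions for $(F,\delta,\Delta)$. Then $\dot x\in F(x,t)$ is uniformly asymptotically stable at $0$. If, in addition, $\mathcal D=\mathbb R^n$ and $\dot x\in F(x,t)$ is uniformly globally stable at $0$, then it is uniformly globally asymptotically stable at $0$. -/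

import Mathlib

open Set Filter Topology MeasureTheory

namespace DiffIncl

/-- The state space `ℝⁿ` with the Euclidean norm. -/
abbrev State (n : ℕ) : Type := EuclideanSpace ℝ (Fin n)

/-- Points `(x, t)` of `ℝⁿ × ℝ`. -/
abbrev Point (n : ℕ) : Type := State n × ℝ

/-- The closed annulus `D(δ, Δ) = {x | δ ≤ ‖x‖ ≤ Δ}`. -/
def annulus (n : ℕ) (δ Δ : ℝ) : Set (State n) := {x | δ ≤ ‖x‖ ∧ ‖x‖ ≤ Δ}

/-! ### Solutions and stability -/

/-- The right-open interval `[s, b)`, where `b` may be `⊤` (that is, `+∞`). -/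
def timeInterval (s : ℝ) (b : EReal) : Set ℝ := {t | s ≤ t ∧ (t : EReal) < b}

/-- `x` is a solution of `ẋ ∈ F(x, t)` on the nondegenerate interval `[s, b)`: it is locally absolutely
continuous there and `ẋ(t)` exists and lies in `F(x(t), t)` for almost every `t ∈ [s, b)`. -/
def IsSolution {n : ℕ} (F : State n → ℝ → Set (State n)) (s : ℝ) (b : EReal)
    (x : ℝ → State n) : Prop :=
  (s : EReal) < b ∧
  (∀ c ∈ timeInterval s b, AbsolutelyContinuousOnInterval x s c) ∧
  ∀ᵐ t ∂(volume : Measure ℝ), t ∈ timeInterval s b → ∃ v ∈ F (x t) t, HasDerivAt x v t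

/-- A solution is maximal if it has no proper right extension which is also a solution. -/
def IsMaximalSolution {n : ℕ} (F : State n → ℝ → Set (State n)) (s : ℝ) (b : EReal)
    (x : ℝ → State n) : Prop :=
  IsSolution F s b x ∧
  ∀ (b' : EReal) (y : ℝ → State n), b < b' → IsSolution F s b' y →
    ¬ EqOn y x (timeInterval s b)

/-- Uniform stability at `0` of `ẋ ∈ F(x, t)`, `t ≥ t₀`; uniformity is with respect to the initial
time `s ≥ t₀`. A solution that starts at time `s` is complete when its interval is `[s, ∞)`. -/
def UniformlyStable {n : ℕ} (F : State n → ℝ → Set (State n)) (t₀ : ℝ) : Prop :=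
  ∀ ε > (0 : ℝ), ∃ δ > (0 : ℝ), ∀ (s : ℝ) (b : EReal) (x : ℝ → State n), t₀ ≤ s →
    IsMaximalSolution F s b x → x s ∈ Metric.closedBall (0 : State n) δ →
      b = ⊤ ∧ ∀ t, s ≤ t → x t ∈ Metric.closedBall (0 : State n) ε

def GloballyUniformlyStable {n : ℕ} (F : State n → ℝ → Set (State n)) (t₀ : ℝ) : Prop :=
  UniformlyStable F t₀ ∧
  ∀ ε > (0 : ℝ), ∃ Δ > (0 : ℝ), ∀ (s : ℝ) (b : EReal) (x : ℝ → State n), t₀ ≤ s →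
    IsMaximalSolution F s b x → x s ∈ Metric.closedBall (0 : State n) ε →
      b = ⊤ ∧ ∀ t, s ≤ t → x t ∈ Metric.closedBall (0 : State n) Δ

def UniformlyAsymptoticallyStable {n : ℕ} (F : State n → ℝ → Set (State n)) (t₀ : ℝ) : Prop :=
  UniformlyStable F t₀ ∧
  ∃ c > (0 : ℝ), ∀ ε > (0 : ℝ), ∃ T ≥ (0 : ℝ), ∀ (s : ℝ) (b : EReal) (x : ℝ → State n), t₀ ≤ s →
    IsMaximalSolution F s b x → x s ∈ Metric.closedBall (0 : State n) c →
      b = ⊤ ∧ ∀ t, s + T ≤ t → x t ∈ Metric.closedBall (0 : State n) ε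

def GloballyUniformlyAsymptoticallyStable {n : ℕ} (F : State n → ℝ → Set (State n)) (t₀ : ℝ) :
    Prop :=
  UniformlyStable F t₀ ∧
  ∀ c > (0 : ℝ), ∀ ε > (0 : ℝ), ∃ T ≥ (0 : ℝ), ∀ (s : ℝ) (b : EReal) (x : ℝ → State n), t₀ ≤ s →
    IsMaximalSolution F s b x → x s ∈ Metric.closedBall (0 : State n) c →
      b = ⊤ ∧ ∀ t, s + T ≤ t → x t ∈ Metric.closedBall (0 : State n) ε

/-! ### Clarke gradients and generalized derivatives

Gradients in `ℝⁿ⁺¹` are written as continuous linear functionals on `ℝⁿ × ℝ`, so that `pᵀ[q; 1]` is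
`p (q, 1)`. -/

/-- The Clarke gradient at `z` of a function `V` with domain `S`: the closed convex hull of all limits
of gradients `∇V(zᵢ)` along sequences `zᵢ → z` of interior points of `S` at which `V` is
differentiable. -/
def clarkeGradient {n : ℕ} (S : Set (Point n)) (V : Point n → ℝ) (z : Point n) :
    Set (Point n →L[ℝ] ℝ) :=
  closure (convexHull ℝ {p | ∃ u : ℕ → Point n,
    (∀ i, u i ∈ interior S ∧ DifferentiableAt ℝ V (u i)) ∧
    Tendsto u atTop (𝓝 z) ∧ Tendsto (fun i => fderiv ℝ V (u i)) atTop (𝓝 p)})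

/-- Clarke's generalized directional derivative
`V°(z; v) = limsup_{y → z, h ↓ 0} (V(y + hv) - V(y)) / h`. -/
noncomputable def clarkeDirDeriv {n : ℕ} (V : Point n → ℝ) (z v : Point n) : ℝ :=
  limsup (fun a : Point n × ℝ => (V (a.1 + a.2 • v) - V a.1) / a.2) (𝓝 z ×ˢ 𝓝[>] (0 : ℝ))

/-- `V` is (Clarke) regular on its domain `S`: at every interior point of `S`, all one-sided
directional derivatives exist and agree with the generalized ones. -/
def ClarkeRegularOn {n : ℕ} (S : Set (Point n)) (V : Point n → ℝ) : Prop :=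
  ∀ z ∈ interior S, ∀ v : Point n,
    Tendsto (fun h : ℝ => (V (z + h • v) - V z) / h) (𝓝[>] 0) (𝓝 (clarkeDirDeriv V z v))

/-- The reduction `G_U^F(x, t)`: directions `q ∈ F(x, t)` for which `pᵀ[q; 1]` takes a single value as
`p` ranges over `∂U(x, t)`. -/
def reduction {n : ℕ} (F : State n → ℝ → Set (State n)) (S : Set (Point n)) (U : Point n → ℝ)
    (x : State n) (t : ℝ) : Set (State n) :=
  {q | q ∈ F x t ∧ ∃ a : ℝ, ∀ p ∈ clarkeGradient S U (x, t), p (q, 1) = a}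

/-- The reduced inclusion `⋂ᵢ G_{Uᵢ}^F` of a sequence `U` of functions with domain `S`. -/
def reducedInclusion {n : ℕ} (F : State n → ℝ → Set (State n)) (S : Set (Point n))
    (U : ℕ → Point n → ℝ) (x : State n) (t : ℝ) : Set (State n) :=
  ⋂ i, reduction F S (U i) x t

open Classical in
/-- The `U`-generalized derivative at `(x, t)`, in the directions `F`, of a function `V` with domain
`Ω`. It is `min_p max_q pᵀ[q; 1]` if `V` is regular and `max_p max_q pᵀ[q; 1]` otherwise, with
`p ∈ ∂V(x, t)` and `q` in the reduced inclusion; it is `⊥ = -∞` if the reduced inclusion is empty. -/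
noncomputable def generalizedDeriv {n : ℕ} (F : State n → ℝ → Set (State n))
    (S : Set (Point n)) (U : ℕ → Point n → ℝ) (Ω : Set (Point n)) (V : Point n → ℝ)
    (x : State n) (t : ℝ) : EReal :=
  if ClarkeRegularOn Ω V then
    ⨅ p ∈ clarkeGradient Ω V (x, t), ⨆ q ∈ reducedInclusion F S U x t, ((p (q, 1) : ℝ) : EReal)
  else
    ⨆ p ∈ clarkeGradient Ω V (x, t), ⨆ q ∈ reducedInclusion F S U x t, ((p (q, 1) : ℝ) : EReal)

/-! ### Matrosov functions -/

/-- The functions `Y₁, …, Y_M` extended by `Y₀ = 0` and `Y_{M+1} = 1`. -/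
noncomputable def extendY {Z : Type*} (M : ℕ) (Y : ℕ → Z → ℝ) (j : ℕ) (w : Z) : ℝ :=
  if j = 0 then 0 else if j ≤ M then Y j w else 1

/-- The nested Matrosov property of `Y₁, …, Y_M` relative to `(γ, δ, Δ)`. -/
def MatrosovProperty {m n : ℕ} (γ δ Δ : ℝ) (M : ℕ) (Y : ℕ → State m × State n → ℝ) : Prop :=
  ∀ j ≤ M, ∀ w ∈ Metric.closedBall (0 : State m) γ ×ˢ annulus n δ Δ,
    (∀ i ≤ j, extendY M Y i w = 0) → extendY M Y (j + 1) w ≤ 0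

/-- `W₁, …, W_M` are Matrosov functions for `(F, δ, Δ)` on `Ω = D × [t₀, ∞)`. Only the indices
`1 ≤ j ≤ M` matter. The regular functions `U i` that reduce the inclusion for the index `j` may be
given on any set `S` that contains `D(δ, Δ) × [t₀, ∞)`, for example on that set itself or on `Ω`. -/
def IsMatrosovFamily {n : ℕ} (D : Set (State n)) (t₀ : ℝ) (F : State n → ℝ → Set (State n))
    (δ Δ : ℝ) (M : ℕ) (W : ℕ → Point n → ℝ) : Prop :=
  (∀ j ∈ Icc 1 M, LocallyLipschitzOn (D ×ˢ Ici t₀) (W j)) ∧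
  ∃ (m : ℕ) (φ : Point n → State m) (γ : ℝ) (Y : ℕ → State m × State n → ℝ),
    0 < γ ∧
    (∀ j ∈ Icc 1 M, ContinuousOn (Y j) (Metric.closedBall (0 : State m) γ ×ˢ annulus n δ Δ)) ∧
    MatrosovProperty γ δ Δ M Y ∧
    (∀ j ∈ Icc 1 M, ∀ x ∈ annulus n δ Δ, ∀ t ∈ Ici t₀, max |W j (x, t)| ‖φ (x, t)‖ ≤ γ) ∧
    ∀ j ∈ Icc 1 M, ∃ (S : Set (Point n)) (U : ℕ → Point n → ℝ),
      annulus n δ Δ ×ˢ Ici t₀ ⊆ S ∧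
      (∀ i, LocallyLipschitzOn S (U i) ∧ ClarkeRegularOn S (U i)) ∧
      ∀ x ∈ annulus n δ Δ, ∀ t ∈ Ici t₀,
        generalizedDeriv F S U (D ×ˢ Ici t₀) (W j) x t ≤ ((Y j (φ (x, t), x) : ℝ) : EReal)

end DiffIncl

/-! Compactness and the nested property give weights `c i ≥ 0` and `η > 0` with `∑ c i * Y i ≤ -η`
on the whole product of ball and annulus (`exists_sum_le_neg`). Along a solution in the open
annulus, for almost every `t` the curve, all `U k` and `W j` along it are differentiable. Regularity
of the `U k` then puts the velocity in the reduced inclusion, so the derivative of `W j` is at most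
its generalized derivative, hence at most `Y j` (`le_generalizedDeriv`). So `∑ c i * W i` decreases
at rate `η` while staying bounded, which bounds the time spent in the annulus uniformly
(`IsMatrosovFamily.exists_exit_time`). A solution kept away from the outer sphere must therefore
reach the small inner ball, where uniform stability holds it near the origin. -/

/-! ### Absolute continuity, mean value inequality and line derivatives. -/

/-- A function whose increments are controlled by those of an absolutely continuous function and of
the identity is absolutely continuous. -/
theorem AbsolutelyContinuousOnInterval.of_dist_le {X Y : Type*} [PseudoMetricSpace X]
    [PseudoMetricSpace Y] {x : ℝ → X} {g : ℝ → Y} {a b K : ℝ}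
    (hx : AbsolutelyContinuousOnInterval x a b)
    (h : ∀ t ∈ uIcc a b, ∀ t' ∈ uIcc a b, dist (g t) (g t') ≤ K * (dist (x t) (x t') + dist t t')) :
    AbsolutelyContinuousOnInterval g a b := by
  have hid : AbsolutelyContinuousOnInterval (fun t : ℝ => t) a b :=
    (LipschitzWith.id.lipschitzOnWith (s := uIcc a b)).absolutelyContinuousOnInterval
  unfold AbsolutelyContinuousOnInterval at hx hid ⊢
  refine squeeze_zero' (.of_forall fun _ => Finset.sum_nonneg fun _ _ => dist_nonneg) ?_
    (by simpa using (hx.add hid).const_mul K)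
  rw [eventually_inf_principal]
  refine .of_forall fun E hE => ?_
  rw [← Finset.sum_add_distrib, Finset.mul_sum]
  exact Finset.sum_le_sum fun i hi => h _ (hE.1 i hi).1 _ (hE.1 i hi).2

/-- An absolutely continuous function whose derivative is almost everywhere at most `c` grows at rate
at most `c`. -/
theorem AbsolutelyContinuousOnInterval.sub_le_of_ae_hasDerivAt_le {g : ℝ → ℝ} {a b c : ℝ}
    (hab : a ≤ b) (hg : AbsolutelyContinuousOnInterval g a b)
    (h : ∀ᵐ t, t ∈ Ioo a b → ∀ d, HasDerivAt g d t → d ≤ c) : g b - g a ≤ c * (b - a) := by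
  rw [← hg.integral_deriv_eq_sub]
  have h1 : ∫ t in a..b, deriv g t ≤ ∫ _ in a..b, c := by
    refine intervalIntegral.integral_mono_ae_restrict hab hg.intervalIntegrable_deriv
      intervalIntegrable_const ?_
    rw [EventuallyLE, ae_restrict_iff' measurableSet_Icc]
    have ha : ∀ᵐ t : ℝ, t ≠ a := by simp [ae_iff, measure_singleton]
    have hb : ∀ᵐ t : ℝ, t ≠ b := by simp [ae_iff, measure_singleton]
    filter_upwards [h, hg.ae_differentiableAt, ha, hb] with t h1 h2 h3 h4 ht
    refine h1 ⟨lt_of_le_of_ne ht.1 (Ne.symm h3), lt_of_le_of_ne ht.2 h4⟩ _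
      (h2 ?_).hasDerivAt
    rwa [uIcc_of_le hab]
  simpa [mul_comm] using h1

/-- A mean value inequality for Lipschitz functions, in terms of the gradients at the points of
differentiability. -/
theorem LipschitzOnWith.sub_le_of_fderiv_le {E : Type*} [NormedAddCommGroup E] [NormedSpace ℝ E]
    [FiniteDimensional ℝ E] [MeasurableSpace E] [BorelSpace E] {f : E → ℝ} {K : NNReal} {z v : E}
    {r c : ℝ} (hf : LipschitzOnWith K f (Metric.ball z r))
    (h : ∀ y ∈ Metric.ball z r, DifferentiableAt ℝ f y → fderiv ℝ f y v ≤ c) {y : E} {τ : ℝ}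
    (hτ : 0 ≤ τ) (hy : y ∈ Metric.ball z r) (hyτ : y + τ • v ∈ Metric.ball z r) :
    f (y + τ • v) - f y ≤ c * τ := by
  obtain ⟨g, hg, hfg⟩ := hf.extend_real
  have hgd : ∀ w ∈ Metric.ball z r, DifferentiableAt ℝ g w → fderiv ℝ g w v ≤ c := by
    intro w hw hgw
    have hEq : f =ᶠ[𝓝 w] g :=
      hfg.eventuallyEq_of_mem (Metric.isOpen_ball.mem_nhds hw)
    rw [← hEq.fderiv_eq]
    exact h w hw (hgw.congr_of_eventuallyEq hEq)
  rw [hfg hy, hfg hyτ]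
  let L : ℝ →ₗ[ℝ] E := LinearMap.toSpanSingleton ℝ E v
  let μ : Measure E := Measure.addHaar
  -- Fubini: on almost every line parallel to `v`, `g` is differentiable at almost every point. Such
  -- lines are dense, and a violation of the inequality is open in the base point, so it can be
  -- moved onto one of them.
  have hae : ∀ᵐ w ∂μ, ∀ᵐ t : ℝ, w + L t ∈ {w | DifferentiableAt ℝ g w} :=
    (ae_ae_add_linearMap_mem_iff L volume μ (measurableSet_of_differentiableAt ℝ g)).2
      hg.ae_differentiableAt
  have hdense := Measure.dense_of_ae hae
  by_contra! hlt
  have hgc := hg.continuous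
  have hopen : IsOpen {w | w ∈ Metric.ball z r ∧ w + τ • v ∈ Metric.ball z r ∧
      c * τ < g (w + τ • v) - g w} := by
    refine Metric.isOpen_ball.inter (IsOpen.inter ?_ ?_)
    · exact Metric.isOpen_ball.preimage (by fun_prop : Continuous fun w : E => w + τ • v)
    · exact isOpen_lt (f := fun _ => c * τ) (g := fun w => g (w + τ • v) - g w) continuous_const
        (by fun_prop)
  obtain ⟨w, ⟨hw, hwτ, hwlt⟩, hwd⟩ := hdense.inter_open_nonempty _ hopen ⟨y, hy, hyτ, hlt⟩
  refine absurd ?_ (not_le.2 hwlt)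
  have hlip : LipschitzWith (K * ‖v‖₊) (fun t : ℝ => g (w + t • v)) := by
    refine hg.comp (LipschitzWith.of_dist_le_mul fun s t => ?_)
    rw [dist_add_left, dist_eq_norm, ← sub_smul, norm_smul, Real.dist_eq, mul_comm]
    rfl
  have hsub := (hlip.lipschitzOnWith (s := uIcc 0 τ)).absolutelyContinuousOnInterval
    |>.sub_le_of_ae_hasDerivAt_le (c := c) hτ (by
      filter_upwards [hwd] with t ht htI d hd
      have ht' : DifferentiableAt ℝ g (w + t • v) := by simpa [L] using ht
      have hmem : w + t • v ∈ Metric.ball z r := by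
        have := (convex_ball z r).add_smul_mem hw hwτ
          (t := t / τ) ⟨div_nonneg htI.1.le hτ, (div_le_one (htI.1.trans htI.2)).2 htI.2.le⟩
        rwa [smul_smul, div_mul_cancel₀ _ (htI.1.trans htI.2).ne'] at this
      have hline : HasDerivAt (fun t : ℝ => w + t • v) v t := by
        simpa using ((hasDerivAt_id t).smul_const v).const_add w
      have := ht'.hasFDerivAt.comp_hasDerivAt t hline
      rw [hd.unique this]
      exact hgd _ hmem ht')
  simpa using hsub

/-- If a curve and its image under a locally Lipschitz function are differentiable, then the function
has a derivative along the tangent line of the curve. -/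
theorem LipschitzOnWith.hasLineDerivAt_of_curve {E : Type*} [NormedAddCommGroup E]
    [NormedSpace ℝ E] {f : E → ℝ} {K : NNReal} {N : Set E} {y : ℝ → E} {v : E} {t d : ℝ}
    (hf : LipschitzOnWith K f N) (hN : N ∈ 𝓝 (y t)) (hy : HasDerivAt y v t)
    (hfy : HasDerivAt (fun s => f (y s)) d t) : HasLineDerivAt ℝ f d (y t) v := by
  rw [hasLineDerivAt_iff_isLittleO_nhds_zero]
  rw [hasDerivAt_iff_isLittleO_nhds_zero] at hfy
  have hy' := hasDerivAt_iff_isLittleO_nhds_zero.1 hy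
  have h1 : ∀ᶠ h : ℝ in 𝓝 0, y (t + h) ∈ N := by
    have : Tendsto (fun h : ℝ => y (t + h)) (𝓝 0) (𝓝 (y t)) := by
      have h2 : ContinuousAt (fun h : ℝ => y (t + h)) 0 := by
        refine ContinuousAt.comp (g := y) ?_ (by fun_prop)
        simpa using hy.continuousAt
      simpa [ContinuousAt] using h2
    exact this hN
  have h2 : ∀ᶠ h : ℝ in 𝓝 0, y t + h • v ∈ N := by
    have : Tendsto (fun h : ℝ => y t + h • v) (𝓝 0) (𝓝 (y t)) := by
      have h2 : ContinuousAt (fun h : ℝ => y t + h • v) 0 := by fun_prop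
      simpa [ContinuousAt] using h2
    exact this hN
  -- The Lipschitz bound makes replacing the curve by its tangent cost only `o(h)`.
  have h3 : (fun h : ℝ => f (y t + h • v) - f (y (t + h))) =o[𝓝 0] fun h => h := by
    refine Asymptotics.IsBigO.trans_isLittleO ?_ hy'
    refine Asymptotics.IsBigO.of_bound K ?_
    filter_upwards [h1, h2] with h hh1 hh2
    refine (hf.norm_sub_le hh2 hh1).trans_eq ?_
    rw [← norm_neg]
    congr 2
    abel
  refine (h3.add hfy).congr_left fun h => ?_
  ring

/-! ### Clarke gradients along curves. -/

namespace DiffIncl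

variable {n : ℕ}

theorem exists_lipschitzOnWith_ball {S : Set (Point n)} {V : Point n → ℝ} {z : Point n}
    (hV : LocallyLipschitzOn S V) (hz : z ∈ interior S) :
    ∃ K : NNReal, ∃ r > 0, Metric.ball z r ⊆ interior S ∧
      LipschitzOnWith K V (Metric.ball z r) := by
  obtain ⟨K, N, hN, hK⟩ := hV (interior_subset hz)
  rw [nhdsWithin_eq_nhds.2 (mem_interior_iff_mem_nhds.1 hz)] at hN
  obtain ⟨r, hr, hrN⟩ :=
    Metric.mem_nhds_iff.1 (inter_mem hN (isOpen_interior.mem_nhds hz))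
  exact ⟨K, r, hr, fun y hy => (hrN hy).2, hK.mono fun y hy => (hrN hy).1⟩

/-- Clarke gradients are dominated by the generalized directional derivative. -/
theorem clarkeGradient_apply_le {S N : Set (Point n)} {V : Point n → ℝ} {K : NNReal} {z : Point n}
    (hV : LipschitzOnWith K V N) (hN : N ∈ 𝓝 z) {p : Point n →L[ℝ] ℝ}
    (hp : p ∈ clarkeGradient S V z) (v : Point n) : p v ≤ clarkeDirDeriv V z v := by
  have hmem : ∀ᶠ a : Point n × ℝ in 𝓝 z ×ˢ 𝓝[>] (0 : ℝ), a.1 ∈ N ∧ a.1 + a.2 • v ∈ N ∧ 0 < a.2 := by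
    have h1 : Tendsto (fun a : Point n × ℝ => a.1 + a.2 • v) (𝓝 z ×ˢ 𝓝[>] (0 : ℝ)) (𝓝 z) := by
      have : ContinuousAt (fun a : Point n × ℝ => a.1 + a.2 • v) (z, 0) := by fun_prop
      have h2 : Tendsto (fun a : Point n × ℝ => a.1 + a.2 • v) (𝓝 z ×ˢ 𝓝 (0 : ℝ)) (𝓝 z) := by
        simpa [ContinuousAt, nhds_prod_eq] using this
      exact h2.mono_left (prod_mono le_rfl nhdsWithin_le_nhds)
    filter_upwards [tendsto_fst.eventually hN, h1.eventually hN,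
      tendsto_snd.eventually self_mem_nhdsWithin] with a h1 h2 h3 using ⟨h1, h2, h3⟩
  -- Without an upper bound the real `limsup` would be a default value and carry no information.
  have hbdd : IsBoundedUnder (· ≤ ·) (𝓝 z ×ˢ 𝓝[>] (0 : ℝ))
      (fun a : Point n × ℝ => (V (a.1 + a.2 • v) - V a.1) / a.2) := by
    refine isBoundedUnder_of_eventually_le (a := K * ‖v‖) ?_
    filter_upwards [hmem] with a ⟨h1, h2, h3⟩
    rw [div_le_iff₀ h3]
    refine (le_abs_self _).trans ((hV.norm_sub_le h2 h1).trans_eq ?_)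
    rw [add_sub_cancel_left, norm_smul, Real.norm_of_nonneg h3.le]
    ring
  -- For each `c` above the limsup, `{p | p v ≤ c}` is closed and convex, so only limits of
  -- gradients need checking.
  refine le_of_forall_gt_imp_ge_of_dense fun c hc => ?_
  have hev := eventually_lt_of_limsup_lt hc hbdd
  have hclosed : IsClosed {p : Point n →L[ℝ] ℝ | p v ≤ c} :=
    isClosed_le (by fun_prop) continuous_const
  have hconv : Convex ℝ {p : Point n →L[ℝ] ℝ | p v ≤ c} :=
    convex_halfSpace_le (f := fun p : Point n →L[ℝ] ℝ => p v)
      ⟨fun _ _ => rfl, fun _ _ => rfl⟩ c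
  refine closure_minimal (convexHull_min ?_ hconv) hclosed hp
  rintro q ⟨u, hu, huz, hq⟩
  have hqv : Tendsto (fun i => fderiv ℝ V (u i) v) atTop (𝓝 (q v)) :=
    ((ContinuousLinearMap.apply ℝ ℝ v).continuous.tendsto q).comp hq
  refine le_of_tendsto hqv ?_
  obtain ⟨A, hA, B, hB, hAB⟩ := Filter.mem_prod_iff.1 hev
  filter_upwards [huz hA] with i hi
  have hline := ((hu i).2.hasFDerivAt.hasLineDerivAt v).tendsto_slope_zero_right
  refine le_of_tendsto hline ?_
  filter_upwards [hB] with h hh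
  have : (u i, h) ∈ A ×ˢ B := ⟨hi, hh⟩
  have := hAB this
  simp only [mem_ofPred_eq] at this
  rw [smul_eq_mul, inv_mul_eq_div]
  exact this.le

/-- The Clarke gradients of a regular function are constant on the directions in which the function
has a two-sided derivative. -/
theorem clarkeGradient_apply_eq_of_hasLineDerivAt {S : Set (Point n)} {V : Point n → ℝ}
    {z v : Point n} {d : ℝ} (hV : LocallyLipschitzOn S V) (hreg : ClarkeRegularOn S V)
    (hz : z ∈ interior S) (hd : HasLineDerivAt ℝ V d z v) {p : Point n →L[ℝ] ℝ}
    (hp : p ∈ clarkeGradient S V z) : p v = d := by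
  obtain ⟨K, r, hr, -, hK⟩ := exists_lipschitzOnWith_ball hV hz
  have key : ∀ (w : Point n) (e : ℝ), HasLineDerivAt ℝ V e z w → p w ≤ e := by
    intro w e he
    have h1 := he.tendsto_slope_zero_right
    have h2 := hreg z hz w
    have : clarkeDirDeriv V z w = e := by
      refine tendsto_nhds_unique h2 (h1.congr fun h => ?_)
      rw [smul_eq_mul, inv_mul_eq_div]
    exact this ▸ clarkeGradient_apply_le hK (Metric.ball_mem_nhds z hr) hp w
  refine le_antisymm (key v d hd) ?_
  -- The derivative is two-sided, so the direction `-v` gives the reverse inequality.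
  have := key (-v) (-d) (by simpa using hd.smul (-1))
  rw [map_neg] at this
  linarith

/-- Gradients near `z` are bounded by the Lipschitz constant, so violations arbitrarily close to `z`
would have a subsequence converging to an element of the Clarke gradient. -/
theorem exists_ball_fderiv_lt {S : Set (Point n)} {V : Point n → ℝ} {z v : Point n} {c : ℝ}
    (hV : LocallyLipschitzOn S V) (hz : z ∈ interior S)
    (hc : ∀ p ∈ clarkeGradient S V z, p v < c) :
    ∃ r > 0, ∀ y ∈ Metric.ball z r, DifferentiableAt ℝ V y → fderiv ℝ V y v ≤ c := by
  obtain ⟨K, r, hr, hrS, hK⟩ := exists_lipschitzOnWith_ball hV hz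
  by_contra! hcon
  have hpos : ∀ i : ℕ, 0 < min r (1 / ((i : ℝ) + 1)) := fun i => lt_min hr (by positivity)
  choose u hu hud huc using fun i : ℕ => hcon _ (hpos i)
  have hur : ∀ i, u i ∈ Metric.ball z r := fun i =>
    Metric.ball_subset_ball (min_le_left _ _) (hu i)
  have huz : Tendsto u atTop (𝓝 z) := by
    rw [tendsto_iff_dist_tendsto_zero]
    refine squeeze_zero (fun _ => dist_nonneg) (fun i => ?_) tendsto_one_div_add_atTop_nhds_zero_nat
    exact (Metric.mem_ball.1 (hu i)).le.trans (min_le_right _ _)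
  have hbdd : ∀ i, fderiv ℝ V (u i) ∈ Metric.closedBall (0 : Point n →L[ℝ] ℝ) K := fun i => by
    rw [mem_closedBall_zero_iff]
    exact norm_fderiv_le_of_lipschitzOn ℝ (Metric.isOpen_ball.mem_nhds (hur i)) hK
  obtain ⟨p, -, σ, hσ, hp⟩ := (isCompact_closedBall (0 : Point n →L[ℝ] ℝ) K).tendsto_subseq hbdd
  have hpmem : p ∈ clarkeGradient S V z := subset_closure (subset_convexHull ℝ _
    ⟨u ∘ σ, fun i => ⟨hrS (hur _), hud _⟩, huz.comp hσ.tendsto_atTop, hp⟩)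
  have hpv : Tendsto (fun i => fderiv ℝ V (u (σ i)) v) atTop (𝓝 (p v)) :=
    ((ContinuousLinearMap.apply ℝ ℝ v).continuous.tendsto p).comp hp
  exact absurd (hc p hpmem) (not_lt.2 (ge_of_tendsto' hpv fun i => (huc _).le))

/-- A line derivative is at most any strict upper bound of the Clarke gradients in that direction. -/
theorem hasLineDerivAt_le_of_clarkeGradient_lt {S : Set (Point n)} {V : Point n → ℝ} {z v : Point n}
    {c d : ℝ} (hV : LocallyLipschitzOn S V) (hz : z ∈ interior S)
    (hc : ∀ p ∈ clarkeGradient S V z, p v < c) (hd : HasLineDerivAt ℝ V d z v) : d ≤ c := by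
  obtain ⟨K, r, hr, -, hK⟩ := exists_lipschitzOnWith_ball hV hz
  obtain ⟨r', hr', hlt⟩ := exists_ball_fderiv_lt hV hz hc
  set ρ := min r r' with hρ
  have hρ0 : 0 < ρ := lt_min hr hr'
  have hcont : ContinuousAt (fun h : ℝ => z + h • v) 0 := by fun_prop
  have hev : ∀ᶠ h : ℝ in 𝓝 0, z + h • v ∈ Metric.ball z ρ :=
    hcont (by simpa using Metric.ball_mem_nhds z hρ0)
  refine le_of_tendsto hd.tendsto_slope_zero_right ?_
  filter_upwards [nhdsWithin_le_nhds hev, self_mem_nhdsWithin] with h hh hpos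
  have hpos' : 0 < h := hpos
  rw [smul_eq_mul, inv_mul_le_iff₀ hpos', mul_comm h c]
  exact (hK.mono (Metric.ball_subset_ball (min_le_left _ _))).sub_le_of_fderiv_le
    (fun y hy => hlt y (Metric.ball_subset_ball (min_le_right _ _) hy)) hpos'.le
    (Metric.mem_ball_self hρ0) hh

/-- Along a differentiable solution curve, the derivative of `V` is at most its generalized
derivative. -/
theorem le_generalizedDeriv {F : State n → ℝ → Set (State n)} {S Ω : Set (Point n)}
    {U : ℕ → Point n → ℝ} {V : Point n → ℝ} {x : ℝ → State n} {t d : ℝ} {q : State n}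
    (hU : ∀ i, LocallyLipschitzOn S (U i) ∧ ClarkeRegularOn S (U i))
    (hV : LocallyLipschitzOn Ω V) (hS : (x t, t) ∈ interior S) (hΩ : (x t, t) ∈ interior Ω)
    (hq : q ∈ F (x t) t) (hx : HasDerivAt x q t)
    (hUd : ∀ i, DifferentiableAt ℝ (fun s => U i (x s, s)) t)
    (hVd : HasDerivAt (fun s => V (x s, s)) d t) :
    (d : EReal) ≤ generalizedDeriv F S U Ω V (x t) t := by
  have hcurve : HasDerivAt (fun s => (x s, s)) (q, (1 : ℝ)) t := hx.prodMk (hasDerivAt_id t)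
  have hline : ∀ {S' : Set (Point n)} {f : Point n → ℝ} {e : ℝ}, LocallyLipschitzOn S' f →
      (x t, t) ∈ interior S' → HasDerivAt (fun s => f (x s, s)) e t →
      HasLineDerivAt ℝ f e (x t, t) (q, (1 : ℝ)) := by
    intro S' f e hf hS' he
    obtain ⟨K, r, hr, -, hK⟩ := exists_lipschitzOnWith_ball hf hS'
    exact hK.hasLineDerivAt_of_curve (y := fun s => (x s, s)) (Metric.ball_mem_nhds _ hr) hcurve he
  have hqr : q ∈ reducedInclusion F S U (x t) t :=
    mem_iInter.2 fun i => ⟨hq, _, fun p hp => clarkeGradient_apply_eq_of_hasLineDerivAt (hU i).1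
      (hU i).2 hS (hline (hU i).1 hS (hUd i).hasDerivAt) hp⟩
  have hle : ∀ p : Point n →L[ℝ] ℝ, ((p (q, 1) : ℝ) : EReal) ≤
      ⨆ q ∈ reducedInclusion F S U (x t) t, ((p (q, 1) : ℝ) : EReal) := fun p =>
    le_iSup₂ (f := fun (q : State n) (_ : q ∈ reducedInclusion F S U (x t) t) =>
      ((p (q, 1) : ℝ) : EReal)) q hqr
  have hVl := hline hV hΩ hVd
  unfold generalizedDeriv
  split_ifs with hreg
  · refine le_iInf₂ fun p hp => ?_
    rw [← clarkeGradient_apply_eq_of_hasLineDerivAt hV hreg hΩ hVl hp]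
    exact hle p
  -- A real `c` strictly between the supremum and `d` supplies the strict bound that the line
  -- derivative estimate needs.
  · by_contra! hlt
    obtain ⟨c, hc1, hc2⟩ := EReal.lt_iff_exists_real_btwn.1 hlt
    refine absurd (EReal.coe_lt_coe_iff.1 hc2)
      (not_lt.2 (hasLineDerivAt_le_of_clarkeGradient_lt hV hΩ (fun p hp => ?_) hVl))
    refine EReal.coe_lt_coe_iff.1 (((hle p).trans ?_).trans_lt hc1)
    exact le_iSup₂ (f := fun (p : Point n →L[ℝ] ℝ) (_ : p ∈ clarkeGradient Ω V (x t, t)) =>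
      ⨆ q ∈ reducedInclusion F S U (x t) t, ((p (q, 1) : ℝ) : EReal)) p hp
-- Compactness and the nested property.
/-- On a compact set, a continuous function that is negative on the zero set of `f ≤ 0` becomes
uniformly negative after adding a large multiple of `f`. -/
theorem exists_mul_add_le_neg {Z : Type*} [TopologicalSpace Z] [T2Space Z] {A : Set Z} {f g : Z → ℝ}
    (hA : IsCompact A) (hf : ContinuousOn f A) (hg : ContinuousOn g A) (hf0 : ∀ w ∈ A, f w ≤ 0)
    {η : ℝ} (hη : 0 < η) (hfg : ∀ w ∈ A, f w = 0 → g w ≤ -η) :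
    ∃ C ≥ (0 : ℝ), ∀ w ∈ A, C * f w + g w ≤ -(η / 2) := by
  obtain ⟨G, hG⟩ := hA.exists_bound_of_continuousOn hg
  -- On this compact bad set `f` is strictly negative, so its maximum there is too.
  have hB : IsCompact (A ∩ g ⁻¹' Ici (-(η / 2))) :=
    hA.of_isClosed_subset (hg.preimage_isClosed_of_isClosed hA.isClosed isClosed_Ici)
      inter_subset_left
  rcases (A ∩ g ⁻¹' Ici (-(η / 2))).eq_empty_or_nonempty with he | hne
  · refine ⟨0, le_rfl, fun w hw => ?_⟩
    by_contra! hlt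
    have : w ∈ A ∩ g ⁻¹' Ici (-(η / 2)) := ⟨hw, by
      simp only [mem_preimage, mem_Ici]; linarith⟩
    rw [he] at this
    exact this
  · obtain ⟨w₀, hw₀, hmax⟩ := hB.exists_isMaxOn hne (hf.mono inter_subset_left)
    have hlt : f w₀ < 0 := by
      refine lt_of_le_of_ne (hf0 _ hw₀.1) fun h0 => ?_
      have h1 := hfg _ hw₀.1 h0
      have h2 : -(η / 2) ≤ g w₀ := hw₀.2
      linarith
    have hG0 : 0 ≤ G := (norm_nonneg _).trans (hG _ hw₀.1)
    -- With this factor the multiple of `f` is at most `-(G + η)` on the bad set, which outweighs `g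
    -- ≤ G`.
    have hC0 : 0 ≤ (G + η) / (-f w₀) := div_nonneg (by linarith) (by linarith)
    refine ⟨(G + η) / (-f w₀), hC0, fun w hw => ?_⟩
    by_cases hgw : -(η / 2) ≤ g w
    · have h1 : f w ≤ f w₀ := hmax ⟨hw, hgw⟩
      have h2 : g w ≤ G := (le_abs_self _).trans (hG w hw)
      have h3 : (G + η) / (-f w₀) * f w ≤ (G + η) / (-f w₀) * f w₀ :=
        mul_le_mul_of_nonneg_left h1 hC0
      have h4 : (G + η) / (-f w₀) * f w₀ = -(G + η) := by
        field_simp [hlt.ne]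
      linarith
    · have := mul_nonpos_of_nonneg_of_nonpos hC0 (hf0 w hw)
      linarith

/-- Functions with the nested Matrosov property on a compact set have a nonnegative combination which
is uniformly negative there. -/
theorem exists_sum_le_neg {Z : Type*} [TopologicalSpace Z] [T2Space Z] {A : Set Z} {M : ℕ}
    {Y : ℕ → Z → ℝ} (hA : IsCompact A) (hY : ∀ j ∈ Icc 1 M, ContinuousOn (Y j) A)
    (hnest : ∀ j ≤ M, ∀ w ∈ A, (∀ i ≤ j, extendY M Y i w = 0) → extendY M Y (j + 1) w ≤ 0) :
    ∃ c : ℕ → ℝ, (∀ i, 0 ≤ c i) ∧ ∃ η > (0 : ℝ), ∀ w ∈ A,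
      ∑ i ∈ Finset.Icc 1 M, c i * Y i w ≤ -η := by
  have hext : ∀ j ≤ M, ∀ w, (∀ i ∈ Icc 1 j, Y i w = 0) → ∀ i ≤ j, extendY M Y i w = 0 := by
    intro j hj w h i hi
    unfold extendY
    split_ifs with h0 hM
    · rfl
    · exact h i ⟨Nat.one_le_iff_ne_zero.2 h0, hi⟩
    · omega
  -- Descending induction on the number `M - k` of functions required to vanish; at `k = M` no
  -- constraint remains.
  suffices H : ∀ k ≤ M, ∃ c : ℕ → ℝ, (∀ i, 0 ≤ c i) ∧ ∃ η > (0 : ℝ), ∀ w ∈ A,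
      (∀ i ∈ Icc 1 (M - k), Y i w = 0) → ∑ i ∈ Finset.Icc 1 M, c i * Y i w ≤ -η by
    obtain ⟨c, hc, η, hη, h⟩ := H M le_rfl
    exact ⟨c, hc, η, hη, fun w hw => h w hw fun i hi => by
      have := hi.1.trans hi.2; omega⟩
  intro k
  induction k with
  | zero =>
    intro _
    -- If all `Y i` vanished, `Y_{M+1} = 1` would be nonpositive; the case is vacuous.
    refine ⟨0, fun _ => le_rfl, 1, one_pos, fun w hw h => ?_⟩
    have := hnest M le_rfl w hw (hext M le_rfl w h)
    unfold extendY at this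
    rw [if_neg (by omega), if_neg (by omega)] at this
    linarith
  | succ k ih =>
    intro hk
    obtain ⟨c, hc, η, hη, h⟩ := ih (by omega)
    obtain ⟨j, hj⟩ : ∃ j, M - k = j + 1 := ⟨M - k - 1, by omega⟩
    have hj' : M - (k + 1) = j := by omega
    have hjM : j + 1 ∈ Finset.Icc 1 M := Finset.mem_Icc.2 ⟨by omega, by omega⟩
    rw [hj] at h
    rw [hj']
    -- On `B` the nested property gives `Y (j + 1) ≤ 0`, and on its zero set there the induction
    -- hypothesis applies.
    set B : Set Z := {w ∈ A | ∀ i ∈ Icc 1 j, Y i w = 0} with hB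
    have hBA : B ⊆ A := fun w hw => hw.1
    have hBc : IsCompact B := by
      have : B = A ∩ ⋂ i ∈ Icc 1 j, (A ∩ Y i ⁻¹' {0}) := by
        ext w
        simp only [hB, mem_inter_iff, mem_iInter, mem_preimage, mem_singleton_iff]
        exact ⟨fun hw => ⟨hw.1, fun i hi => ⟨hw.1, hw.2 i hi⟩⟩, fun hw => ⟨hw.1, fun i hi =>
          (hw.2 i hi).2⟩⟩
      rw [this]
      refine hA.inter_right (isClosed_biInter fun i hi => ?_)
      exact (hY i ⟨hi.1, by have := hi.2; omega⟩).preimage_isClosed_of_isClosed hA.isClosed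
        isClosed_singleton
    obtain ⟨C, hC, hle⟩ := exists_mul_add_le_neg (A := B) (f := Y (j + 1))
      (g := fun w => ∑ i ∈ Finset.Icc 1 M, c i * Y i w) hBc
      ((hY _ (by simpa using hjM)).mono hBA)
      (continuousOn_finsetSum _ fun i hi =>
        continuousOn_const.mul ((hY i (by simpa using hi)).mono hBA))
      (fun w hw => by
        have := hnest j (by omega) w hw.1 (hext j (by omega) w hw.2)
        unfold extendY at this
        rwa [if_neg (by omega), if_pos (by omega)] at this)
      hη (fun w hw h0 => h w hw.1 fun i hi => by
        rcases Nat.lt_or_ge j i with hij | hij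
        · rw [show i = j + 1 from le_antisymm hi.2 hij]; exact h0
        · exact hw.2 i ⟨hi.1, hij⟩)
    refine ⟨fun i => c i + if i = j + 1 then C else 0, fun i => ?_, η / 2, by linarith,
      fun w hw h0 => ?_⟩
    · dsimp only
      split_ifs
      · exact add_nonneg (hc i) hC
      · simpa using hc i
    · have := hle w ⟨hw, h0⟩
      simp only [add_mul, Finset.sum_add_distrib, ite_mul, zero_mul]
      rw [Finset.sum_ite_eq', if_pos hjM]
      linarith

/-! ### Solutions in an annulus and the exit time. -/

theorem isCompact_annulus (δ Δ : ℝ) : IsCompact (annulus n δ Δ) := by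
  refine (isCompact_closedBall (0 : State n) Δ).of_isClosed_subset ?_ fun x hx => by
    simpa using hx.2
  exact (isClosed_le continuous_const continuous_norm).inter
    (isClosed_le continuous_norm continuous_const)

/-- The curve over `[s, s + T]` has compact image, on which the local Lipschitz constants merge into
one. -/
theorem IsSolution.absolutelyContinuous_of_locallyLipschitzOn {F : State n → ℝ → Set (State n)}
    {s T : ℝ} {x : ℝ → State n} {S : Set (Point n)} {V : Point n → ℝ} (hT : 0 ≤ T)
    (hx : IsSolution F s ⊤ x) (hV : LocallyLipschitzOn S V)
    (hS : ∀ t ∈ Icc s (s + T), (x t, t) ∈ S) :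
    AbsolutelyContinuousOnInterval (fun t => V (x t, t)) s (s + T) := by
  have hac := hx.2.1 (s + T) ⟨by linarith, EReal.coe_lt_top _⟩
  have hI : uIcc s (s + T) = Icc s (s + T) := uIcc_of_le (by linarith)
  have hcont : ContinuousOn (fun t => (x t, t)) (Icc s (s + T)) :=
    (hI ▸ hac.continuousOn).prodMk continuousOn_id
  obtain ⟨K, hK⟩ := (hV.mono (image_subset_iff.2 hS)).exists_lipschitzOnWith_of_compact
    (isCompact_Icc.image_of_continuousOn hcont)
  refine hac.of_dist_le (K := K) fun t ht t' ht' => ?_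
  rw [hI] at ht ht'
  refine (hK.dist_le_mul _ (mem_image_of_mem _ ht) _ (mem_image_of_mem _ ht')).trans ?_
  rw [Prod.dist_eq]
  exact mul_le_mul_of_nonneg_left
    (max_le (le_add_of_nonneg_right dist_nonneg) (le_add_of_nonneg_left dist_nonneg)) K.2

/-- The gradient calculus works only at interior points, and `S` may be no larger than the closed
annulus times `[t₀, ∞)`; hence the strict inequalities. -/
theorem mem_interior_of_annulus_prod_subset {S : Set (Point n)} {t₀ δ Δ t : ℝ}
    {x : State n} (hS : annulus n δ Δ ×ˢ Ici t₀ ⊆ S) (hx : δ < ‖x‖) (hx' : ‖x‖ < Δ) (ht : t₀ < t) :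
    (x, t) ∈ interior S := by
  refine mem_interior.2 ⟨{x : State n | δ < ‖x‖ ∧ ‖x‖ < Δ} ×ˢ Ioi t₀, ?_, ?_, ⟨hx, hx'⟩, ht⟩
  · exact fun p hp => hS ⟨⟨hp.1.1.le, hp.1.2.le⟩, (mem_Ioi.1 hp.2).le⟩
  · exact ((isOpen_lt continuous_const continuous_norm).inter
      (isOpen_lt continuous_norm continuous_const)).prod isOpen_Ioi

/-- If there are Matrosov functions on an annulus, then solutions cannot remain in its interior
beyond a uniform time. -/
theorem IsMatrosovFamily.exists_exit_time {D : Set (State n)} {t₀ δ Δ : ℝ}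
    {F : State n → ℝ → Set (State n)} {M : ℕ} {W : ℕ → Point n → ℝ} (hD : annulus n δ Δ ⊆ D)
    (hW : IsMatrosovFamily D t₀ F δ Δ M W) :
    ∃ T ≥ (0 : ℝ), ∀ (s : ℝ) (x : ℝ → State n), t₀ ≤ s → IsSolution F s ⊤ x →
      ∃ t ∈ Icc s (s + T), ¬ (δ < ‖x t‖ ∧ ‖x t‖ < Δ) := by
  obtain ⟨hWlip, m, φ, γ, Y, hγ, hYc, hMat, hbd, hgen⟩ := hW
  obtain ⟨c, hc, η, hη, hsum⟩ := exists_sum_le_neg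
    ((isCompact_closedBall (0 : State m) γ).prod (isCompact_annulus δ Δ)) hYc hMat
  have hG0 : 0 ≤ ∑ i ∈ Finset.Icc 1 M, c i * γ :=
    Finset.sum_nonneg fun i _ => mul_nonneg (hc i) hγ.le
  set G := ∑ i ∈ Finset.Icc 1 M, c i * γ with hG
  have hT0 : 0 ≤ 2 * G / η + 1 := by positivity
  -- A quantity in `[-G, G]` can fall at rate `η` for time at most `2 * G / η`; the extra `1` makes
  -- the contradiction strict.
  refine ⟨2 * G / η + 1, hT0, fun s x hs hx => ?_⟩
  set T := 2 * G / η + 1 with hT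
  by_contra! hcon
  have hann : ∀ t ∈ Icc s (s + T), x t ∈ annulus n δ Δ := fun t ht =>
    ⟨(hcon t ht).1.le, (hcon t ht).2.le⟩
  have hYsum : ∀ t ∈ Icc s (s + T),
      ∑ i ∈ Finset.Icc 1 M, c i * Y i (φ (x t, t), x t) ≤ -η := by
    intro t ht
    -- For `M = 0` the bound on `φ` is vacuous, but the sum is empty, so `0` serves in place of `φ
    -- (x t, t)`.
    rcases Nat.eq_zero_or_pos M with rfl | hM
    · have := hsum (0, x t) ⟨Metric.mem_closedBall_self hγ.le, hann t ht⟩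
      simpa using this
    · refine hsum _ ⟨?_, hann t ht⟩
      rw [mem_closedBall_zero_iff]
      exact (le_max_right _ _).trans (hbd 1 ⟨le_rfl, hM⟩ _ (hann t ht) t (hs.trans ht.1))
  have hac : ∀ i ∈ Finset.Icc 1 M,
      AbsolutelyContinuousOnInterval (fun t => W i (x t, t)) s (s + T) := fun i hi =>
    hx.absolutelyContinuous_of_locallyLipschitzOn hT0 (hWlip i (by simpa using hi)) fun t ht =>
      ⟨hD (hann t ht), hs.trans ht.1⟩
  have hderiv : ∀ i ∈ Finset.Icc 1 M, ∀ᵐ t, t ∈ Ioo s (s + T) →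
      ∃ d ≤ Y i (φ (x t, t), x t), HasDerivAt (fun t => W i (x t, t)) d t := by
    intro i hi
    obtain ⟨S, U, hS, hU, hle⟩ := hgen i (by simpa using hi)
    have hUac : ∀ k, AbsolutelyContinuousOnInterval (fun t => U k (x t, t)) s (s + T) := fun k =>
      hx.absolutelyContinuous_of_locallyLipschitzOn hT0 (hU k).1 fun t ht =>
        hS ⟨hann t ht, hs.trans ht.1⟩
    -- Countability of the collection yields one null set for all `k`.
    have hUd := ae_all_iff.2 fun k => (hUac k).ae_differentiableAt
    filter_upwards [hUd, (hac i hi).ae_differentiableAt, hx.2.2] with t h1 h2 h3 ht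
    have htI : t ∈ Icc s (s + T) := ⟨ht.1.le, ht.2.le⟩
    have htu : t ∈ uIcc s (s + T) := Icc_subset_uIcc htI
    obtain ⟨q, hq, hxq⟩ := h3 ⟨ht.1.le, EReal.coe_lt_top _⟩
    have htl : t₀ < t := hs.trans_lt ht.1
    refine ⟨_, ?_, (h2 htu).hasDerivAt⟩
    refine EReal.coe_le_coe_iff.1 (le_trans ?_ (hle _ (hann t htI) t htl.le))
    exact le_generalizedDeriv hU (hWlip i (by simpa using hi))
      (mem_interior_of_annulus_prod_subset hS (hcon t htI).1 (hcon t htI).2 htl)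
      (mem_interior_of_annulus_prod_subset (prod_mono hD le_rfl) (hcon t htI).1 (hcon t htI).2 htl)
      hq hxq (fun k => h1 k htu) (h2 htu).hasDerivAt
  have hVac : AbsolutelyContinuousOnInterval
      (fun t => ∑ i ∈ Finset.Icc 1 M, c i * W i (x t, t)) s (s + T) := by
    have : ∀ I ⊆ Finset.Icc 1 M, AbsolutelyContinuousOnInterval
        (fun t => ∑ i ∈ I, c i * W i (x t, t)) s (s + T) := by
      intro I
      induction I using Finset.induction_on with
      | empty =>
        intro _
        simpa using ((LipschitzWith.const (0 : ℝ)).lipschitzOnWith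
          (s := uIcc s (s + T))).absolutelyContinuousOnInterval
      | insert a I ha ih =>
        intro hI
        simp only [Finset.sum_insert ha]
        exact ((hac a (hI (Finset.mem_insert_self _ _))).const_mul (c a)).fun_add
          (ih ((Finset.subset_insert _ _).trans hI))
    exact this _ subset_rfl
  have hdec := hVac.sub_le_of_ae_hasDerivAt_le (c := -η) (by linarith) (by
    filter_upwards [(Finset.eventually_all _).2 hderiv] with t h ht d hd
    choose! e he hed using fun i hi => h i hi ht
    have h1 : HasDerivAt (fun t => ∑ i ∈ Finset.Icc 1 M, c i * W i (x t, t))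
        (∑ i ∈ Finset.Icc 1 M, c i * e i) t :=
      HasDerivAt.fun_sum fun i hi => (hed i hi).const_mul (c i)
    rw [hd.unique h1]
    exact (Finset.sum_le_sum fun i hi => mul_le_mul_of_nonneg_left (he i hi) (hc i)).trans
      (hYsum t ⟨ht.1.le, ht.2.le⟩))
  have hVb : ∀ t ∈ Icc s (s + T), |∑ i ∈ Finset.Icc 1 M, c i * W i (x t, t)| ≤ G := by
    intro t ht
    refine (Finset.abs_sum_le_sum_abs _ _).trans (Finset.sum_le_sum fun i hi => ?_)
    rw [abs_mul, abs_of_nonneg (hc i)]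
    exact mul_le_mul_of_nonneg_left ((le_max_left _ _).trans
      (hbd i (by simpa using hi) _ (hann t ht) t (hs.trans ht.1))) (hc i)
  have h1 := abs_le.1 (hVb s ⟨le_rfl, by linarith⟩)
  have h2 := abs_le.1 (hVb (s + T) ⟨by linarith, le_rfl⟩)
  have h3 : η * T = 2 * G + η := by
    rw [hT]; field_simp
  simp only [add_sub_cancel_left] at hdec
  linarith [h1.2, h2.1]

/-! ### Convergence from stability and exit times. -/

theorem IsSolution.tail {F : State n → ℝ → Set (State n)} {s s' : ℝ} {x : ℝ → State n}
    (hs : s ≤ s') (hx : IsSolution F s ⊤ x) : IsSolution F s' ⊤ x := by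
  refine ⟨EReal.coe_lt_top _, fun c hc => ?_, ?_⟩
  · refine (hx.2.1 c ⟨hs.trans hc.1, hc.2⟩).mono ?_
    rw [uIcc_of_le hc.1, uIcc_of_le (hs.trans hc.1)]
    exact Icc_subset_Icc_left hs
  · filter_upwards [hx.2.2] with t ht h using ht ⟨hs.trans h.1, h.2⟩

/-- Stability speaks of maximal solutions only; this lets it apply to a tail restarted at the exit
time. -/
theorem IsSolution.isMaximal_of_top {F : State n → ℝ → Set (State n)} {s : ℝ} {x : ℝ → State n}
    (hx : IsSolution F s ⊤ x) : IsMaximalSolution F s ⊤ x :=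
  ⟨hx, fun _ _ hb => absurd hb not_top_lt⟩

/-- Under uniform stability and the existence of Matrosov functions, the complete solutions that stay
in a closed ball inside the domain converge uniformly to the origin. -/
theorem UniformlyStable.exists_time_of_bounded {D : Set (State n)} {t₀ R R' : ℝ}
    {F : State n → ℝ → Set (State n)} (hstable : UniformlyStable F t₀)
    (hMatrosov : ∀ δ Δ : ℝ, 0 < δ → δ < Δ → annulus n δ Δ ⊆ D →
      ∃ (M : ℕ) (W : ℕ → Point n → ℝ), IsMatrosovFamily D t₀ F δ Δ M W)
    (hR : 0 < R) (hRR : R < R') (hD : Metric.closedBall (0 : State n) R' ⊆ D) {ε : ℝ}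
    (hε : 0 < ε) :
    ∃ T ≥ (0 : ℝ), ∀ (s : ℝ) (x : ℝ → State n), t₀ ≤ s → IsSolution F s ⊤ x →
      (∀ t, s ≤ t → x t ∈ Metric.closedBall (0 : State n) R) →
      ∀ t, s + T ≤ t → x t ∈ Metric.closedBall (0 : State n) ε := by
  obtain ⟨δ, hδ, hstab⟩ := hstable ε hε
  -- The minimum with `R` keeps the inner radius below `R'`. Since `R < R'`, the exit can only be
  -- through the inner sphere.
  have hann : annulus n (min δ R) R' ⊆ D := fun x hx => hD (by simpa using hx.2)
  obtain ⟨M, W, hW⟩ := hMatrosov (min δ R) R' (lt_min hδ hR) ((min_le_right _ _).trans_lt hRR) hann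
  obtain ⟨T, hT, hexit⟩ := hW.exists_exit_time hann
  refine ⟨T, hT, fun s x hs hx hbd t ht => ?_⟩
  obtain ⟨s', hs', hout⟩ := hexit s x hs hx
  have hle : ‖x s'‖ ≤ δ := by
    by_contra! hlt
    refine hout ⟨(min_le_left _ _).trans_lt hlt, ?_⟩
    exact (mem_closedBall_zero_iff.1 (hbd s' hs'.1)).trans_lt hRR
  exact (hstab s' ⊤ x (hs.trans hs'.1) (hx.tail hs'.1).isMaximal_of_top
    (mem_closedBall_zero_iff.2 hle)).2 t (hs'.2.trans ht)

end DiffIncl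

theorem mainTheorem7 (n : ℕ) (D : Set (DiffIncl.State n)) (hD_open : IsOpen D)
    (hD_conn : IsConnected D) (hD0 : (0 : DiffIncl.State n) ∈ D) (t₀ : ℝ)
    (F : DiffIncl.State n → ℝ → Set (DiffIncl.State n))
    (hF : ∀ x, ∀ t, t₀ ≤ t → IsCompact (F x t))
    (hstable : DiffIncl.UniformlyStable F t₀)
    (hMatrosov : ∀ δ Δ : ℝ, 0 < δ → δ < Δ → DiffIncl.annulus n δ Δ ⊆ D →
      ∃ (M : ℕ) (W : ℕ → DiffIncl.Point n → ℝ), DiffIncl.IsMatrosovFamily D t₀ F δ Δ M W) :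
    DiffIncl.UniformlyAsymptoticallyStable F t₀ ∧
      (D = univ → DiffIncl.GloballyUniformlyStable F t₀ →
        DiffIncl.GloballyUniformlyAsymptoticallyStable F t₀) := by
  refine ⟨⟨hstable, ?_⟩, fun hD hglob => ⟨hstable, fun c hc ε hε => ?_⟩⟩
  · obtain ⟨r, hr, hrD⟩ := Metric.isOpen_iff.1 hD_open 0 hD0
    -- Solutions are trapped in radius `r / 3`, leaving room for the outer radius `r / 2` inside the
    -- domain; `c` is fixed before `ε`.
    obtain ⟨c, hc, hstab⟩ := hstable (r / 3) (by positivity)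
    refine ⟨c, hc, fun ε hε => ?_⟩
    obtain ⟨T, hT, h⟩ := hstable.exists_time_of_bounded (R := r / 3) (R' := r / 2) hMatrosov
      (by positivity) (by linarith)
      ((Metric.closedBall_subset_ball (by linarith)).trans hrD) hε
    refine ⟨T, hT, fun s b x hs hx hxs => ?_⟩
    obtain ⟨rfl, hbd⟩ := hstab s b x hs hx hxs
    exact ⟨rfl, h s x hs hx.1 hbd⟩
  · obtain ⟨R, hR, hbound⟩ := hglob.2 c hc
    obtain ⟨T, hT, h⟩ := hstable.exists_time_of_bounded (R := R) (R' := R + 1) hMatrosov hR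
      (by linarith) (hD ▸ subset_univ _) hε
    refine ⟨T, hT, fun s b x hs hx hxs => ?_⟩
    obtain ⟨rfl, hbd⟩ := hbound s b x hs hx hxs
    exact ⟨rfl, h s x hs hx.1 hbd⟩
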